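/- Throughout, "countable group" means a group of cardinality exactly $\aleph_0$. An action of a group $G$ on a set $X$ is \emph{amenable} if there is a map $\mu$ from the collection of all subsets of $X$ to $[0,1]$ with $\mu(X)=1$, with $\mu(A\cup B)=\mu(A)+\mu(B)$ whenever $A\cap B=\varnothing$, and with $\mu(gA)=\mu(A)$ for all $g\in G$ and $A\subseteq X$. Let $\mathcal A$ be the class of countable groups that admit a faithful, transitive, amenable action on some set. A countable group has \emph{property (F)} if each of its amenable actions on a (finite or infinite) countable set has a fixed point, and it has \emph{virtually (F)} if one of its subgroups of finite index has property (F). \textbf{Theorem.} Let $G$ and $H$ be countable groups. Then the free product $G*H$ belongs to $\mathcal A$ if and only if neither of the following holds: (a) $G$ has property (F) and $H$ has virtually (F); (b) $H$ has property (F) and $G$ has virtually (F). -/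

import Mathlib

/-- An invariant mean for an action of `G` on a set `X`: a finitely additive map from the collection
of all subsets of `X` to `[0,1]`, of total mass one and invariant under `G`. -/
structure IsInvariantMean (G : Type*) {X : Type*} [Group G] [MulAction G X]
    (μ : Set X → ℝ) : Prop where
  mem_Icc : ∀ A : Set X, μ A ∈ Set.Icc (0 : ℝ) 1
  union_of_disjoint : ∀ A B : Set X, Disjoint A B → μ (A ∪ B) = μ A + μ B
  univ : μ Set.univ = 1
  invariant : ∀ (g : G) (A : Set X), μ ((fun x : X => g • x) '' A) = μ A

/-- The action of `G` on `X` is amenable if it has an invariant mean. (In particular `X` is then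
non-empty.) -/
def IsAmenableAction (G X : Type*) [Group G] [MulAction G X] : Prop :=
  ∃ μ : Set X → ℝ, IsInvariantMean G μ

/-- The class of countably infinite groups admitting a faithful transitive amenable action.
A set with a transitive action of a countable group is countable, hence in bijection with a type
in `Type`, whatever the universe of `G`. -/
def InClassA (G : Type*) [Group G] : Prop :=
  Countable G ∧ Infinite G ∧
    ∃ (X : Type) (_ : MulAction G X),
      FaithfulSMul G X ∧ MulAction.IsPretransitive G X ∧ IsAmenableAction G X

/-- The fixed point property (F): every amenable action on a countable set has a fixed point.
Every countable set is in bijection with a type in `Type`; finite sets are included. -/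
def PropertyF (G : Type*) [Group G] : Prop :=
  ∀ (X : Type) [Countable X] [MulAction G X],
    IsAmenableAction G X → (MulAction.fixedPoints G X).Nonempty

/-- `G` has virtually (F) if some subgroup of finite index has property (F). -/
def VirtuallyF (G : Type*) [Group G] : Prop :=
  ∃ K : Subgroup G, K.FiniteIndex ∧ PropertyF K

/-!
Write `W = G * H`. The following three observations decide the question.

*Obstruction.* If `G` has (F) and acts with an invariant mean, the mean is carried by the fixed
points of `G`, as it could otherwise be restricted to the remaining points
(`PropertyF.apply_compl_fixedPoints`). If moreover `K ≤ H` has finite index and (F), almost every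
point `x` of an amenable `W`-set is fixed by `K`, and each of the finitely many points of `H x` is
fixed by `G`. So `W x` is finite, which excludes faithful transitive actions
(`not_inClassA_of_propertyF`).

*Rewiring.* An invariant mean does not notice changes on a null set. Let `W` act on a countable
set `Z` with an invariant mean, and let `T` be a null set that is `G`-invariant and meets all
orbits. Add a regular orbit of `W`, of mass zero, and let `G` act on the union of `T` and of the
subset `G` of the new orbit by a transported regular action, without any other change. Orbits are
only merged, and all of them are merged into one. An element `w ≠ 1` still acts by left
multiplication on the new orbit outside of finitely many left cosets of `G`, so the action remains
faithful (`inClassA_of_null_set`). Thus it suffices to find `Z` and `T`.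

*Finding `Z` and `T`.* If `H` has amenable actions with arbitrarily large orbits, let `Z` be a
disjoint union of such `H`-sets, with trivial action of `G`; a transversal for the orbits of `H`
can be chosen to be null (`HasLargeOrbitActions.inClassA`). The same works with `G` and `H`
exchanged. A group without such actions has virtually (F) (`hasLargeOrbitActions_of_not_virtuallyF`),
and it has (F) unless it has a proper subgroup of finite index
(`PropertyF.of_not_hasLargeOrbitActions`). So the only remaining case is that `G` and `H` act
transitively on finite sets `A` and `B` with at least two points. Then `W` acts transitively on
`A × B × ℤ`, where `H` acts on `B`, and `G` acts on `A` up to conjugation by the shift of `ℤ` at a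
single point of `A × B`. Uniform distributions on long boxes converge to an invariant mean without
atoms, and `T` can be any orbit of `G` (`inClassA_of_finite_actions`).
-/

open Filter Topology
open Monoid (Coprod)

/-! ### Calculus of invariant means -/

namespace IsInvariantMean

variable {G X : Type*} [Group G] [MulAction G X] {μ : Set X → ℝ}

theorem nonneg (h : IsInvariantMean G μ) (A : Set X) : 0 ≤ μ A := (h.mem_Icc A).1

theorem apply_empty (h : IsInvariantMean G μ) : μ ∅ = 0 := by
  have := h.union_of_disjoint ∅ ∅ (by simp)
  simp only [Set.union_self] at this
  linarith

theorem inter_add_diff (h : IsInvariantMean G μ) (A B : Set X) :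
    μ (A ∩ B) + μ (A \ B) = μ A := by
  rw [← h.union_of_disjoint _ _ Set.disjoint_sdiff_inter.symm, Set.inter_union_sdiff]

theorem mono (h : IsInvariantMean G μ) {A B : Set X} (hAB : A ⊆ B) : μ A ≤ μ B := by
  have := h.inter_add_diff B A
  rw [Set.inter_eq_self_of_subset_right hAB] at this
  linarith [h.nonneg (B \ A)]

theorem union_le (h : IsInvariantMean G μ) (A B : Set X) : μ (A ∪ B) ≤ μ A + μ B := by
  have := h.union_of_disjoint A (B \ A) Set.disjoint_sdiff_right
  rw [Set.union_sdiff_self] at this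
  linarith [h.mono (Set.sdiff_subset : B \ A ⊆ B)]

theorem iUnion_null {ι : Type*} [Finite ι] (h : IsInvariantMean G μ) (A : ι → Set X)
    (hA : ∀ i, μ (A i) = 0) : μ (⋃ i, A i) = 0 := by
  classical
  have := Fintype.ofFinite ι
  have key : ∀ s : Finset ι, μ (⋃ i ∈ s, A i) = 0 := by
    intro s
    induction s using Finset.induction_on with
    | empty => simpa using h.apply_empty
    | insert a s _ ih =>
      rw [Finset.set_biUnion_insert]
      linarith [h.union_le (A a) (⋃ i ∈ s, A i), hA a, h.nonneg (A a ∪ ⋃ i ∈ s, A i)]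
  simpa using key Finset.univ

/-- A mean does not see the points of a null set. -/
theorem congr_of_null (h : IsInvariantMean G μ) {N A B : Set X} (hN : μ N = 0)
    (hAB : ∀ x, x ∉ N → (x ∈ A ↔ x ∈ B)) : μ A = μ B := by
  have null : ∀ C : Set X, μ (C ∩ N) = 0 := fun C =>
    le_antisymm (hN ▸ h.mono Set.inter_subset_right) (h.nonneg _)
  rw [← h.inter_add_diff A N, ← h.inter_add_diff B N, null, null]
  congr 2
  ext x
  simp only [Set.mem_sdiff]
  exact ⟨fun hx => ⟨(hAB x hx.2).1 hx.1, hx.2⟩, fun hx => ⟨(hAB x hx.2).2 hx.1, hx.2⟩⟩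

theorem preimage_smul (h : IsInvariantMean G μ) (g : G) (A : Set X) :
    μ ((fun x => g • x) ⁻¹' A) = μ A := by
  rw [← h.invariant g, Set.image_preimage_eq _ (MulAction.surjective g)]

theorem of_preimage_smul (h01 : ∀ A, μ A ∈ Set.Icc (0 : ℝ) 1)
    (hadd : ∀ A B, Disjoint A B → μ (A ∪ B) = μ A + μ B) (huniv : μ Set.univ = 1)
    (hinv : ∀ (g : G) A, μ ((fun x => g • x) ⁻¹' A) = μ A) : IsInvariantMean G μ where
  mem_Icc := h01
  union_of_disjoint := hadd
  univ := huniv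
  invariant g A := by
    rw [← hinv g, Set.preimage_image_eq _ (MulAction.injective g)]

/-- The push-forward of an invariant mean along a map that intertwines each `k : K` with some
element `φ k` of `G`. -/
theorem map {K Y : Type*} [Group K] [MulAction K Y] (h : IsInvariantMean G μ) (φ : K → G)
    (f : X → Y) (hf : ∀ k x, f (φ k • x) = k • f x) :
    IsInvariantMean K (fun A : Set Y => μ (f ⁻¹' A)) := by
  refine of_preimage_smul (fun A => h.mem_Icc _)
    (fun A B hAB => h.union_of_disjoint _ _ (hAB.preimage f)) h.univ fun k A => ?_
  refine Eq.trans (congrArg μ ?_) (h.preimage_smul (φ k) _)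
  ext x
  simp [hf]

/-- A mean that charges an invariant set can be restricted to it and renormalized. -/
theorem restrict_isAmenableAction (h : IsInvariantMean G μ) (Y : SubMulAction G X)
    (hY : μ (Y : Set X) ≠ 0) : IsAmenableAction G Y := by
  have hpos : 0 < μ (Y : Set X) := lt_of_le_of_ne (h.nonneg _) hY.symm
  refine ⟨fun A => μ ((↑) '' A : Set X) / μ (Y : Set X), ?_, ?_, ?_, ?_⟩
  · intro A
    have : μ ((↑) '' A : Set X) ≤ μ (Y : Set X) := h.mono (by rintro _ ⟨y, -, rfl⟩; exact y.2)
    exact ⟨div_nonneg (h.nonneg _) hpos.le, (div_le_one hpos).2 this⟩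
  · intro A B hAB
    rw [Set.image_union, h.union_of_disjoint _ _
      ((Set.disjoint_image_iff Subtype.val_injective).2 hAB), add_div]
  · have : ((↑) '' (Set.univ : Set Y) : Set X) = Y := by simp
    rw [this, div_self hY]
  · intro g A
    congr 1
    rw [← h.invariant g (Subtype.val '' A), Set.image_image, Set.image_image]
    rfl

end IsInvariantMean

/-- Limits of means along an ultrafilter: a sequence of finitely additive probabilities that is
asymptotically invariant has an invariant limit, which vanishes on every set whose mass tends
to zero. -/
theorem exists_isInvariantMean_of_tendsto {G X : Type*} [Group G] [MulAction G X]
    (m : ℕ → Set X → ℝ) (h01 : ∀ n A, m n A ∈ Set.Icc (0 : ℝ) 1)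
    (hadd : ∀ n A B, Disjoint A B → m n (A ∪ B) = m n A + m n B)
    (huniv : ∀ n, m n Set.univ = 1)
    (hinv : ∀ (g : G) A,
      Tendsto (fun n => m n ((fun x => g • x) ⁻¹' A) - m n A) atTop (𝓝 0)) :
    ∃ μ : Set X → ℝ, IsInvariantMean G μ ∧
      ∀ A, Tendsto (fun n => m n A) atTop (𝓝 0) → μ A = 0 := by
  have hlim : ∀ A, ∃ a ∈ Set.Icc (0 : ℝ) 1,
      Tendsto (fun n => m n A) (hyperfilter ℕ : Filter ℕ) (𝓝 a) := by
    intro A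
    obtain ⟨a, ha, hle⟩ := (isCompact_Icc (a := (0 : ℝ)) (b := 1)).ultrafilter_le_nhds
      ((hyperfilter ℕ).map fun n => m n A)
      (by
        rw [Ultrafilter.coe_map]
        exact tendsto_principal.2 (Eventually.of_forall fun n => h01 n A))
    exact ⟨a, ha, hle⟩
  have hle : (hyperfilter ℕ : Filter ℕ) ≤ atTop := by
    rw [← Nat.cofinite_eq_atTop]; exact hyperfilter_le_cofinite
  choose μ hμ hμlim using hlim
  refine ⟨μ, .of_preimage_smul hμ (fun A B hAB => ?_) ?_ (fun g A => ?_), fun A hA => ?_⟩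
  · refine tendsto_nhds_unique (hμlim (A ∪ B)) ?_
    simpa only [hadd _ A B hAB] using (hμlim A).add (hμlim B)
  · refine tendsto_nhds_unique (hμlim Set.univ) ?_
    simp only [huniv]
    exact tendsto_const_nhds
  · have := tendsto_nhds_unique ((hinv g A).mono_left hle) ((hμlim _).sub (hμlim A))
    linarith
  · exact tendsto_nhds_unique (hμlim A) (hA.mono_left hle)

/-! ### Groups with property (F) -/

/-- A group with (F) fixes almost every point, for every invariant mean: otherwise the mean could
be restricted to the invariant set of points that are not fixed. -/
theorem PropertyF.apply_compl_fixedPoints {G : Type*} [Group G] (hG : PropertyF G) {X : Type}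
    [Countable X] [MulAction G X] {μ : Set X → ℝ} (h : IsInvariantMean G μ) :
    μ (MulAction.fixedPoints G X)ᶜ = 0 := by
  by_contra hne
  let Y : SubMulAction G X :=
    { carrier := (MulAction.fixedPoints G X)ᶜ
      smul_mem' := by
        intro g x hx hgx
        refine hx fun k => ?_
        have h1 := hgx (k * g)
        have h2 := hgx (g * k * g⁻¹)
        have h3 : g • k • x = g • x := by
          simpa [mul_smul] using h2
        exact MulAction.injective g h3 }
  obtain ⟨y, hy⟩ := hG Y (h.restrict_isAmenableAction Y hne)
  exact y.2 fun g => congrArg Subtype.val (hy g)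

/-- If `G` has (F) and `K` of finite index in `H` has (F), then almost every point `x` is fixed
by `K` and has all of `H x` inside the fixed points of `G`; the orbit of such a point is the
finite set `H x`. -/
theorem not_inClassA_of_propertyF {G H : Type*} [Group G] [Group H] [Infinite G]
    (hG : PropertyF G) (hH : VirtuallyF H) : ¬ InClassA (Coprod G H) := by
  rintro ⟨hcount, -, X, _, hfaith, htrans, μ, hμ⟩
  obtain ⟨K, hK, hKF⟩ := hH
  have hne : Nonempty X := by
    by_contra hX
    rw [not_nonempty_iff] at hX
    have := hμ.univ
    rw [Set.univ_eq_empty_iff.2 hX, hμ.apply_empty] at this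
    exact zero_ne_one this
  obtain ⟨x₀⟩ := hne
  have : Countable X := (MulAction.surjective_smul (Coprod G H) x₀).countable
  let : MulAction G X := MulAction.compHom X (Coprod.inl : G →* Coprod G H)
  let : MulAction H X := MulAction.compHom X (Coprod.inr : H →* Coprod G H)
  have hμG : IsInvariantMean G μ := by
    simpa using hμ.map (Y := X) (Coprod.inl : G →* Coprod G H) id (fun _ _ => rfl)
  have hμH : IsInvariantMean H μ := by
    simpa using hμ.map (Y := X) (Coprod.inr : H →* Coprod G H) id (fun _ _ => rfl)
  have hμK : IsInvariantMean K μ := by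
    simpa using hμH.map (Y := X) ((↑) : K → H) id (fun _ _ => rfl)
  have h1 := hG.apply_compl_fixedPoints hμG
  have h2 := hKF.apply_compl_fixedPoints hμK
  have : Finite (H ⧸ K) := Subgroup.finite_quotient_of_finiteIndex
  have h3 : μ (⋃ c : H ⧸ K, (fun x => c.out • x) ⁻¹' (MulAction.fixedPoints G X)ᶜ) = 0 :=
    hμ.iUnion_null _ fun c => by rw [hμH.preimage_smul, h1]
  have h4 : μ ((MulAction.fixedPoints K X)ᶜ ∪
      ⋃ c : H ⧸ K, (fun x => c.out • x) ⁻¹' (MulAction.fixedPoints G X)ᶜ) = 0 :=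
    le_antisymm ((hμ.union_le _ _).trans (by rw [h2, h3, add_zero])) (hμ.nonneg _)
  obtain ⟨x, hx⟩ : ∃ x, x ∉ (MulAction.fixedPoints K X)ᶜ ∪
      ⋃ c : H ⧸ K, (fun x => c.out • x) ⁻¹' (MulAction.fixedPoints G X)ᶜ := by
    by_contra! hall
    rw [Set.eq_univ_of_forall hall, hμ.univ] at h4
    exact one_ne_zero h4
  simp only [Set.mem_union, Set.mem_compl_iff, Set.mem_iUnion, Set.mem_preimage, not_or, not_not,
    not_exists] at hx
  obtain ⟨hxK, hxG⟩ := hx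
  have hout : ∀ h : H, h • x = (h : H ⧸ K).out • x := by
    intro h
    obtain ⟨k, hk⟩ := QuotientGroup.mk_out_eq_mul K h
    have : (k : H) • x = x := hxK k
    rw [hk, mul_smul, this]
  have horb : ∀ w : Coprod G H, ∃ c : H ⧸ K, w • x = c.out • x := by
    intro w
    induction w using Coprod.induction_on' with
    | one => exact ⟨((1 : H) : H ⧸ K), by rw [← hout, one_smul, one_smul]⟩
    | inl_mul g w ih =>
      obtain ⟨c, hc⟩ := ih
      exact ⟨c, by rw [mul_smul, hc]; exact hxG c g⟩
    | inr_mul h w ih =>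
      obtain ⟨c, hc⟩ := ih
      exact ⟨((h * c.out : H) : H ⧸ K), by rw [← hout, mul_smul, hc, mul_smul]; rfl⟩
  have hfin : Finite X := by
    refine Finite.of_surjective (fun c : H ⧸ K => c.out • x) fun y => ?_
    obtain ⟨w, rfl⟩ := MulAction.exists_smul_eq (Coprod G H) x y
    obtain ⟨c, hc⟩ := horb w
    exact ⟨c, hc.symm⟩
  have : Finite (Coprod G H) :=
    Finite.of_injective _ (MulAction.toPerm_injective (α := Coprod G H) (β := X))
  have : Finite G := Finite.of_injective _ (Coprod.inl_injective (M := G) (N := H))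
  exact not_finite G

/-! ### Moving actions along bijections and isomorphisms -/

/-- Every countable set is in bijection with a type in `Type`, and actions can be transported. -/
theorem exists_mulAction_of_countable (G : Type*) (X : Type*) [Group G] [MulAction G X]
    [Countable X] :
    ∃ (Y : Type) (_ : MulAction G Y) (e : X ≃ Y), ∀ (g : G) x, e (g • x) = g • e x := by
  refine ⟨Shrink.{0} X, (equivShrink.{0} X).symm.mulAction G, equivShrink.{0} X, fun g x => ?_⟩
  change _ = equivShrink.{0} X (g • (equivShrink.{0} X).symm (equivShrink.{0} X x))
  rw [Equiv.symm_apply_apply]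

theorem inClassA_of_permHom {G X : Type*} [Group G] [Countable G] [Infinite G] [Countable X]
    (ψ : G →* Equiv.Perm X) (hinj : Function.Injective ψ) (htrans : ∀ x y, ∃ g, ψ g x = y)
    {μ : Set X → ℝ} (h01 : ∀ A, μ A ∈ Set.Icc (0 : ℝ) 1)
    (hadd : ∀ A B, Disjoint A B → μ (A ∪ B) = μ A + μ B) (huniv : μ Set.univ = 1)
    (hinv : ∀ g A, μ (ψ g ⁻¹' A) = μ A) : InClassA G := by
  let : MulAction G X := MulAction.compHom X ψ
  have hμ : IsInvariantMean G μ := .of_preimage_smul h01 hadd huniv hinv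
  obtain ⟨Y, _, e, he⟩ := exists_mulAction_of_countable G X
  refine ⟨inferInstance, inferInstance, Y, inferInstance, ⟨fun {g k} hgk => ?_⟩, ⟨fun y z => ?_⟩,
    _, hμ.map id e he⟩
  · refine hinj (Equiv.ext fun x => e.injective ?_)
    exact (he g x).trans ((hgk _).trans (he k x).symm)
  · obtain ⟨g, hg⟩ := htrans (e.symm y) (e.symm z)
    refine ⟨g, ?_⟩
    rw [← e.apply_symm_apply y, ← he, ← e.apply_symm_apply z, ← hg]
    rfl

theorem InClassA.of_mulEquiv {G H : Type*} [Group G] [Group H] (e : G ≃* H) (h : InClassA G) :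
    InClassA H := by
  obtain ⟨_, _, X, _, _, _, μ, hμ⟩ := h
  refine ⟨e.toEquiv.countable_iff.1 inferInstance, e.toEquiv.infinite_iff.1 inferInstance, X,
    MulAction.compHom X e.symm.toMonoidHom, ?_⟩
  let := MulAction.compHom X e.symm.toMonoidHom
  refine ⟨⟨fun {g k} hgk => ?_⟩, ⟨fun x y => ?_⟩, _, hμ.map e.symm id fun _ _ => rfl⟩
  · exact e.symm.injective (FaithfulSMul.eq_of_smul_eq_smul (α := X) hgk)
  · obtain ⟨g, hg⟩ := MulAction.exists_smul_eq G x y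
    refine ⟨e g, ?_⟩
    change e.symm (e g) • x = y
    rw [e.symm_apply_apply, hg]

/-! ### Rewiring an action of a free product along a null set -/

section Rewire

variable {G H Z : Type*} [Group G] [Group H] [MulAction (Coprod G H) Z] {D : Set Z}

/-- The map `z ↦ g z` for the action of the left factor of `G * H`, replaced on the set `D` by left
multiplication by `g` on `G`, transported by a bijection `e : D ≃ G`. -/
noncomputable def rewiredSMul (H : Type*) [Group H] [MulAction (Coprod G H) Z] (e : D ≃ G) (g : G)
    (z : Z) : Z :=
  open Classical in
  if hz : z ∈ D then e.symm (g * e ⟨z, hz⟩) else (Coprod.inl g : Coprod G H) • z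

theorem rewiredSMul_of_mem (e : D ≃ G) (g : G) {z : Z} (hz : z ∈ D) :
    rewiredSMul H e g z = e.symm (g * e ⟨z, hz⟩) :=
  dif_pos hz

theorem rewiredSMul_of_notMem (e : D ≃ G) (g : G) {z : Z} (hz : z ∉ D) :
    rewiredSMul H e g z = (Coprod.inl g : Coprod G H) • z :=
  dif_neg hz

/-- When `D` is invariant under the left factor `G` of `G * H`, the maps `rewiredSMul` are an
action of `G`. -/
noncomputable def rewiredHom
    (hD : ∀ (g : G), ∀ z ∈ D, (Coprod.inl g : Coprod G H) • z ∈ D) (e : D ≃ G) :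
    G →* Equiv.Perm Z :=
  MonoidHom.toHomPerm
    { toFun := fun g z => rewiredSMul H e g z
      map_one' := by
        funext z
        change rewiredSMul H e 1 z = z
        by_cases hz : z ∈ D
        · simp [rewiredSMul_of_mem e 1 hz]
        · simp [rewiredSMul_of_notMem e 1 hz]
      map_mul' := by
        intro g k
        funext z
        change rewiredSMul H e (g * k) z = rewiredSMul H e g (rewiredSMul H e k z)
        by_cases hz : z ∈ D
        · rw [rewiredSMul_of_mem e k hz, rewiredSMul_of_mem e _ (Subtype.coe_prop _),
            rewiredSMul_of_mem e _ hz]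
          simp [mul_assoc]
        · have hk : (Coprod.inl k : Coprod G H) • z ∉ D := fun hk => hz (by
            simpa [smul_smul, ← map_mul] using hD k⁻¹ _ hk)
          rw [rewiredSMul_of_notMem e k hz, rewiredSMul_of_notMem e _ hk,
            rewiredSMul_of_notMem e _ hz, map_mul, mul_smul] }

variable (hD : ∀ (g : G), ∀ z ∈ D, (Coprod.inl g : Coprod G H) • z ∈ D) (e : D ≃ G)

theorem rewiredHom_apply_of_mem (g : G) {z : Z} (hz : z ∈ D) :
    rewiredHom hD e g z = e.symm (g * e ⟨z, hz⟩) :=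
  rewiredSMul_of_mem e g hz

theorem rewiredHom_apply_of_notMem (g : G) {z : Z} (hz : z ∉ D) :
    rewiredHom hD e g z = (Coprod.inl g : Coprod G H) • z :=
  rewiredSMul_of_notMem e g hz

/-- The action of `G * H` in which `G` acts by `rewiredHom` and `H` acts as before. -/
noncomputable def rewiredAction : Coprod G H →* Equiv.Perm Z :=
  Coprod.lift (rewiredHom hD e)
    ((MulAction.toPermHom (Coprod G H) Z).comp (Coprod.inr : H →* Coprod G H))

theorem rewiredAction_inl (g : G) :
    rewiredAction hD e (Coprod.inl g) = rewiredHom hD e g := rfl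

theorem rewiredAction_inr_apply (h : H) (z : Z) :
    rewiredAction hD e (Coprod.inr h) z = (Coprod.inr h : Coprod G H) • z := rfl

theorem exists_rewiredAction_eq_of_mem {y z : Z} (hy : y ∈ D) (hz : z ∈ D) :
    ∃ w, rewiredAction hD e w y = z :=
  ⟨Coprod.inl (e ⟨z, hz⟩ * (e ⟨y, hy⟩)⁻¹), by
    rw [rewiredAction_inl, rewiredHom_apply_of_mem hD e _ hy]; simp⟩

/-- Rewiring only merges orbits. -/
theorem exists_rewiredAction_eq_smul (v : Coprod G H) (z : Z) :
    ∃ w, rewiredAction hD e w z = v • z := by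
  induction v using Coprod.induction_on' with
  | one => exact ⟨1, by simp⟩
  | inl_mul g v ih =>
    obtain ⟨w, hw⟩ := ih
    by_cases hv : v • z ∈ D
    · obtain ⟨u, hu⟩ := exists_rewiredAction_eq_of_mem hD e hv (hD g _ hv)
      exact ⟨u * w, by rw [map_mul, Equiv.Perm.mul_apply, hw, hu, mul_smul]⟩
    · refine ⟨Coprod.inl g * w, ?_⟩
      rw [map_mul, Equiv.Perm.mul_apply, hw, rewiredAction_inl,
        rewiredHom_apply_of_notMem hD e g hv, mul_smul]
  | inr_mul h v ih =>
    obtain ⟨w, hw⟩ := ih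
    exact ⟨Coprod.inr h * w, by
      rw [map_mul, Equiv.Perm.mul_apply, hw, rewiredAction_inr_apply, mul_smul]⟩

theorem rewiredAction_transitive (hmeet : ∀ z : Z, ∃ v : Coprod G H, v • z ∈ D) (y z : Z) :
    ∃ w, rewiredAction hD e w y = z := by
  obtain ⟨u, hu⟩ := hmeet y
  obtain ⟨v, hv⟩ := hmeet z
  obtain ⟨a, ha⟩ := exists_rewiredAction_eq_smul hD e u y
  obtain ⟨b, hb⟩ := exists_rewiredAction_eq_smul hD e v z
  obtain ⟨c, hc⟩ := exists_rewiredAction_eq_of_mem hD e hu hv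
  refine ⟨b⁻¹ * c * a, ?_⟩
  rw [map_mul, map_mul, map_inv, Equiv.Perm.mul_apply, Equiv.Perm.mul_apply, ha, hc, ← hb]
  exact Equiv.symm_apply_apply _ z

/-- An invariant mean for which `D` is null is also invariant for the rewired action. -/
theorem rewiredAction_preimage {μ : Set Z → ℝ} (hμ : IsInvariantMean (Coprod G H) μ)
    (hnull : μ D = 0) (w : Coprod G H) (A : Set Z) :
    μ (rewiredAction hD e w ⁻¹' A) = μ A := by
  induction w using Coprod.induction_on' generalizing A with
  | one => simp
  | inl_mul g w ih =>
    rw [map_mul, Equiv.Perm.coe_mul, Set.preimage_comp, ih, ← hμ.preimage_smul (Coprod.inl g) A]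
    refine hμ.congr_of_null hnull fun z hz => ?_
    rw [Set.mem_preimage, rewiredAction_inl, rewiredHom_apply_of_notMem hD e g hz]
    rfl
  | inr_mul h w ih =>
    rw [map_mul, Equiv.Perm.coe_mul, Set.preimage_comp, ih, ← hμ.preimage_smul (Coprod.inr h) A]
    rfl

/-- If `Z` contains an equivariant copy of the regular action that meets `D` only in `G`, the
rewired and the original action of `w` differ on this copy in finitely many left cosets of `G`
at most. -/
theorem exists_finite_rewiredAction_ne (f : Coprod G H → Z) (hf : ∀ w x, f (w * x) = w • f x)
    (hfD : ∀ x, f x ∈ D → ∃ g : G, x = Coprod.inl g) (w : Coprod G H) :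
    ∃ F : Set (Coprod G H), F.Finite ∧
      ∀ x, rewiredAction hD e w (f x) ≠ f (w * x) → ∃ a ∈ F, ∃ g : G, x = a * Coprod.inl g := by
  induction w using Coprod.induction_on' with
  | one => exact ⟨∅, Set.finite_empty, fun x hx => absurd (by simp) hx⟩
  | inl_mul g w ih =>
    obtain ⟨F, hF, hFx⟩ := ih
    refine ⟨insert w⁻¹ F, hF.insert _, fun x hx => ?_⟩
    by_cases h : rewiredAction hD e w (f x) = f (w * x)
    · rw [map_mul, Equiv.Perm.mul_apply, h, rewiredAction_inl] at hx
      have hmem : f (w * x) ∈ D := by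
        by_contra hmem
        exact hx (by rw [rewiredHom_apply_of_notMem hD e g hmem, ← hf, mul_assoc])
      obtain ⟨k, hk⟩ := hfD _ hmem
      exact ⟨w⁻¹, Set.mem_insert _ _, k, by rw [← hk, inv_mul_cancel_left]⟩
    · obtain ⟨a, ha, k, hk⟩ := hFx x h
      exact ⟨a, Set.mem_insert_of_mem _ ha, k, hk⟩
  | inr_mul h w ih =>
    obtain ⟨F, hF, hFx⟩ := ih
    refine ⟨F, hF, fun x hx => hFx x fun hx' => hx ?_⟩
    rw [map_mul, Equiv.Perm.mul_apply, hx', rewiredAction_inr_apply, ← hf, mul_assoc]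

/-- The elements of `H` lie in different left cosets of `G`, so one of them avoids the finitely
many cosets on which the rewired action of `w` is not that of left multiplication. -/
theorem rewiredAction_injective [Infinite H] (f : Coprod G H → Z) (hinj : Function.Injective f)
    (hf : ∀ w x, f (w * x) = w • f x) (hfD : ∀ x, f x ∈ D → ∃ g : G, x = Coprod.inl g) :
    Function.Injective (rewiredAction hD e) := by
  rw [injective_iff_map_eq_one]
  intro w hw
  obtain ⟨F, hF, hFx⟩ := exists_finite_rewiredAction_ne hD e f hf hfD w
  obtain ⟨h, hh⟩ : ∃ h : H, h ∉ Coprod.snd '' F := by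
    by_contra! hall
    exact Set.infinite_univ ((hF.image Coprod.snd).subset fun h _ => hall h)
  have : rewiredAction hD e w (f (Coprod.inr h)) = f (w * Coprod.inr h) := by
    by_contra hne
    obtain ⟨a, ha, g, hg⟩ := hFx _ hne
    refine hh ⟨a, ha, ?_⟩
    simpa using (congrArg Coprod.snd hg).symm
  rw [hw, Equiv.Perm.one_apply] at this
  exact right_eq_mul.1 (hinj this)

end Rewire

/-- An amenable action of `G * H` on a countable set, with a null set `T` that is invariant
under `G` and meets every orbit, puts `G * H` into the class: add a regular orbit of `G * H`,
of mass zero, and rewire `G` along the union of `T` and the copy of `G` in the new orbit. -/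
theorem inClassA_of_null_set {G H Z : Type*} [Group G] [Group H] [Countable G] [Infinite G]
    [Countable H] [Infinite H] [Countable Z] [MulAction (Coprod G H) Z] {μ : Set Z → ℝ}
    (hμ : IsInvariantMean (Coprod G H) μ) (T : Set Z)
    (hT : ∀ (g : G), ∀ z ∈ T, (Coprod.inl g : Coprod G H) • z ∈ T)
    (hmeet : ∀ z : Z, ∃ v : Coprod G H, v • z ∈ T) (hnull : μ T = 0) :
    InClassA (Coprod G H) := by
  have : Countable (Coprod G H) := Coprod.mk_surjective.countable
  have : Infinite (Coprod G H) := Infinite.of_injective _ (Coprod.inl_injective (M := G) (N := H))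
  let D : Set (Z ⊕ Coprod G H) :=
    Sum.inl '' T ∪ Set.range fun g : G => Sum.inr (Coprod.inl g : Coprod G H)
  have hD : ∀ (g : G), ∀ z ∈ D, (Coprod.inl g : Coprod G H) • z ∈ D := by
    rintro g _ (⟨z, hz, rfl⟩ | ⟨k, rfl⟩)
    · exact Or.inl ⟨_, hT g z hz, rfl⟩
    · exact Or.inr ⟨g * k, by simp [Sum.smul_inr]⟩
  have : Infinite D := Infinite.of_injective
    (fun g : G => (⟨Sum.inr (Coprod.inl g), Or.inr ⟨g, rfl⟩⟩ : D))
    fun g k hgk => Coprod.inl_injective (Sum.inr_injective (congrArg Subtype.val hgk))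
  obtain ⟨e⟩ : Nonempty (D ≃ G) := nonempty_equiv_of_countable
  have hν := hμ.map (Y := Z ⊕ Coprod G H) id Sum.inl (fun _ _ => rfl)
  have hνD : μ (Sum.inl ⁻¹' D) = 0 := by
    rw [← hnull]
    congr 1
    ext z
    simp [D]
  have hmeet' : ∀ z : Z ⊕ Coprod G H, ∃ v : Coprod G H, v • z ∈ D := by
    rintro (z | x)
    · obtain ⟨v, hv⟩ := hmeet z
      exact ⟨v, Or.inl ⟨_, hv, rfl⟩⟩
    · exact ⟨x⁻¹, Or.inr ⟨1, by simp [Sum.smul_inr]⟩⟩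
  have hinj := rewiredAction_injective hD e Sum.inr Sum.inr_injective (fun _ _ => rfl) (by
    rintro x (⟨_, _, h⟩ | ⟨g, h⟩)
    · cases h
    · exact ⟨g, (Sum.inr_injective h).symm⟩)
  exact inClassA_of_permHom (rewiredAction hD e) hinj (rewiredAction_transitive hD e hmeet')
    hν.mem_Icc hν.union_of_disjoint hν.univ (rewiredAction_preimage hD e hν hνD)

/-! ### Amenable actions with large orbits -/

/-- For every `n`, the group has an amenable action on a countable set all of whose orbits have at
least `n` points. -/
def HasLargeOrbitActions (H : Type*) [Group H] : Prop :=
  ∀ n : ℕ, ∃ (X : Type) (_ : Countable X) (_ : MulAction H X), IsAmenableAction H X ∧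
    ∀ x : X, (n : ℕ∞) ≤ (MulAction.orbit H x).encard

theorem IsInvariantMean.apply_biUnion_finset {G X ι : Type*} [Group G] [MulAction G X]
    {μ : Set X → ℝ} (h : IsInvariantMean G μ) (A : ι → Set X)
    (hA : Pairwise (Function.onFun Disjoint A)) (s : Finset ι) :
    μ (⋃ i ∈ s, A i) = ∑ i ∈ s, μ (A i) := by
  classical
  induction s using Finset.induction_on with
  | empty => simpa using h.apply_empty
  | insert a s ha ih =>
    rw [Finset.set_biUnion_insert, Finset.sum_insert ha, h.union_of_disjoint, ih]
    simp only [Set.disjoint_iUnion_right]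
    exact fun i hi => hA fun hai => ha (hai ▸ hi)

/-- Orbits with more than `n` points allow for `n + 1` disjoint transversals, one of which has
small mass. -/
theorem IsInvariantMean.exists_transversal {H X : Type*} [Group H] [MulAction H X]
    {μ : Set X → ℝ} (hμ : IsInvariantMean H μ) (n : ℕ)
    (horb : ∀ x : X, ((n + 1 : ℕ) : ℕ∞) ≤ (MulAction.orbit H x).encard) :
    ∃ T : Set X, (∀ x, ∃ h : H, h • x ∈ T) ∧ μ T ≤ 1 / (n + 1) := by
  have hf : ∀ q : MulAction.orbitRel.Quotient H X, ∃ f : Fin (n + 1) → X,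
      Function.Injective f ∧ ∀ i, f i ∈ MulAction.orbit H q.out := by
    intro q
    obtain ⟨t, ht, hcard⟩ := Set.exists_subset_encard_eq (horb q.out)
    have hfin : t.Finite := Set.finite_of_encard_eq_coe hcard
    have : Finite t := hfin
    have hn : Nat.card t = n + 1 := by
      rw [Nat.card_coe_set_eq, Set.ncard, hcard, ENat.toNat_natCast]
    exact ⟨fun i => (Finite.equivFinOfCardEq hn).symm i,
      Subtype.val_injective.comp (Equiv.injective _), fun i => ht (Subtype.coe_prop _)⟩
  choose f hinj hmem using hf
  have hq : ∀ q i, (Quotient.mk'' (f q i) : MulAction.orbitRel.Quotient H X) = q := fun q i => by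
    conv_rhs => rw [← Quotient.out_eq' q]
    exact Quotient.sound' (hmem q i)
  let T : Fin (n + 1) → Set X := fun i => Set.range fun q => f q i
  have hdisj : Pairwise (Function.onFun Disjoint T) := by
    intro i j hij
    refine Set.disjoint_left.2 ?_
    rintro _ ⟨q, rfl⟩ ⟨r, hr⟩
    have hqr : r = q := by rw [← hq r j, ← hq q i]; exact congrArg _ hr
    subst hqr
    exact hij (hinj _ hr).symm
  obtain ⟨i, hi⟩ : ∃ i, μ (T i) ≤ 1 / (n + 1) := by
    by_contra! hlt
    have h1 := hμ.apply_biUnion_finset T hdisj Finset.univ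
    have h2 := (hμ.mem_Icc (⋃ i ∈ Finset.univ, T i)).2
    have h3 : ∑ _i : Fin (n + 1), (1 / ((n : ℝ) + 1)) < ∑ i, μ (T i) :=
      Finset.sum_lt_sum_of_nonempty Finset.univ_nonempty fun i _ => hlt i
    rw [Finset.sum_const, Finset.card_univ, Fintype.card_fin, nsmul_eq_mul, Nat.cast_add,
      Nat.cast_one, mul_one_div_cancel (by positivity)] at h3
    linarith
  refine ⟨T i, fun x => ?_, hi⟩
  have hx := Quotient.exact' (hq (Quotient.mk'' x) i)
  obtain ⟨h, hh⟩ : f (Quotient.mk'' x) i ∈ MulAction.orbit H x := hx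
  exact ⟨h, _, hh.symm⟩

/-- Let `G` act trivially on the disjoint union of `H`-sets whose orbits get larger and larger. In
the limit, a suitable transversal for the orbits of `H` is a null set. -/
theorem HasLargeOrbitActions.inClassA {G H : Type*} [Group G] [Group H] [Countable G] [Infinite G]
    [Countable H] [Infinite H] (hH : HasLargeOrbitActions H) : InClassA (Coprod G H) := by
  choose X hX iX hA horb using fun n : ℕ => hH (n + 1)
  choose μ hμ using hA
  choose T hT hTle using fun n => (hμ n).exists_transversal n (horb n)
  let : MulAction (Coprod G H) (Σ n, X n) :=
    MulAction.compHom _ (Coprod.snd : Coprod G H →* H)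
  have hsmul : ∀ (w : Coprod G H) (n : ℕ) (x : X n),
      w • (⟨n, x⟩ : Σ n, X n) = ⟨n, Coprod.snd w • x⟩ := fun _ _ _ => rfl
  obtain ⟨ν, hν, hν0⟩ := exists_isInvariantMean_of_tendsto (G := Coprod G H)
    (fun n (A : Set (Σ n, X n)) => μ n (Sigma.mk n ⁻¹' A))
    (fun n A => (hμ n).mem_Icc _)
    (fun n A B hAB => (hμ n).union_of_disjoint _ _ (hAB.preimage _)) (fun n => (hμ n).univ)
    (fun w A => by
      have : ∀ n, μ n (Sigma.mk n ⁻¹' ((fun z => w • z) ⁻¹' A)) = μ n (Sigma.mk n ⁻¹' A) :=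
        fun n => (hμ n).preimage_smul (Coprod.snd w) (Sigma.mk n ⁻¹' A)
      simp only [this, sub_self]
      exact tendsto_const_nhds)
  refine inClassA_of_null_set hν {z | z.2 ∈ T z.1} (fun g z hz => ?_) (fun z => ?_)
    (hν0 _ (squeeze_zero (fun n => (hμ n).nonneg _) hTle tendsto_one_div_add_atTop_nhds_zero_nat))
  · obtain ⟨n, x⟩ := z
    rw [hsmul, Coprod.snd_apply_inl, one_smul]
    exact hz
  · obtain ⟨n, x⟩ := z
    obtain ⟨h, hh⟩ := hT n x
    exact ⟨Coprod.inr h, by rw [hsmul]; exact hh⟩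

/-! ### Finite index subgroups and induced actions -/

theorem exists_countable_type_le_encard_orbit {H X : Type*} [Group H] [MulAction H X]
    [Countable X] (hA : IsAmenableAction H X) {n : ℕ∞}
    (hn : ∀ x : X, n ≤ (MulAction.orbit H x).encard) :
    ∃ (Y : Type) (_ : Countable Y) (_ : MulAction H Y), IsAmenableAction H Y ∧
      ∀ y : Y, n ≤ (MulAction.orbit H y).encard := by
  obtain ⟨Y, _, e, he⟩ := exists_mulAction_of_countable H X
  obtain ⟨μ, hμ⟩ := hA
  refine ⟨Y, e.symm.injective.countable, inferInstance, ⟨_, hμ.map id e he⟩, fun y => ?_⟩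
  obtain ⟨x, rfl⟩ := e.surjective y
  refine (hn x).trans ?_
  rw [← e.injective.encard_image]
  refine Set.encard_le_encard ?_
  rintro _ ⟨_, ⟨h, rfl⟩, rfl⟩
  exact ⟨h, (he h x).symm⟩

theorem isAmenableAction_of_finite (G X : Type*) [Group G] [MulAction G X] [Finite X]
    [Nonempty X] : IsAmenableAction G X := by
  have hpos : (0 : ℝ) < Nat.card X := Nat.cast_pos.2 Nat.card_pos
  refine ⟨fun A => A.ncard / Nat.card X, fun A => ⟨by positivity, ?_⟩, fun A B hAB => ?_, ?_,
    fun g A => ?_⟩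
  · exact (div_le_one hpos).2 (Nat.cast_le.2 (Set.ncard_le_card A))
  · rw [Set.ncard_union_eq hAB, Nat.cast_add, add_div]
  · rw [Set.ncard_univ, div_self hpos.ne']
  · rw [Set.ncard_image_of_injective _ (MulAction.injective g)]

section Induced

variable {H : Type*} [Group H] (K : Subgroup H) (X : Type*) [MulAction K X]

/-- The element of `K` that compares `h s(c)` with `s(h c)`, where `s` is the chosen section of
`H → H ⧸ K`. -/
noncomputable def inducedCocycle (h : H) (c : H ⧸ K) : K :=
  ⟨(h • c).out⁻¹ * (h * c.out), QuotientGroup.eq.1 (by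
    rw [QuotientGroup.out_eq', ← smul_eq_mul, MulAction.Quotient.coe_smul_out])⟩

/-- The action of `H` induced by an action of `K`, on `(H ⧸ K) × X` by means of a section. -/
@[reducible] noncomputable def inducedMulAction : MulAction H ((H ⧸ K) × X) where
  smul h z := (h • z.1, inducedCocycle K h z.1 • z.2)
  one_smul := by
    rintro ⟨c, x⟩
    have : inducedCocycle K 1 c = 1 := Subtype.ext (by simp [inducedCocycle])
    change ((1 : H) • c, inducedCocycle K 1 c • x) = _
    rw [this, one_smul, one_smul]
  mul_smul := by
    rintro h k ⟨c, x⟩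
    have : inducedCocycle K (h * k) c = inducedCocycle K h (k • c) * inducedCocycle K k c :=
      Subtype.ext (by simp [inducedCocycle, mul_smul, mul_assoc])
    change ((h * k) • c, inducedCocycle K (h * k) c • x) =
      (h • k • c, inducedCocycle K h (k • c) • inducedCocycle K k c • x)
    rw [this, mul_smul, mul_smul]

variable {X}

theorem isAmenableAction_induced [K.FiniteIndex] (hA : IsAmenableAction K X) :
    letI := inducedMulAction K X
    IsAmenableAction H ((H ⧸ K) × X) := by
  let := inducedMulAction K X
  obtain ⟨μ, hμ⟩ := hA
  have : Fintype (H ⧸ K) := Fintype.ofFinite _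
  have hpos : (0 : ℝ) < Fintype.card (H ⧸ K) := Nat.cast_pos.2 Fintype.card_pos
  refine ⟨fun A => (∑ c : H ⧸ K, μ (Prod.mk c ⁻¹' A)) / Fintype.card (H ⧸ K),
    .of_preimage_smul (fun A => ⟨?_, ?_⟩) (fun A B hAB => ?_) ?_ fun h A => ?_⟩
  · exact div_nonneg (Finset.sum_nonneg fun c _ => hμ.nonneg _) hpos.le
  · refine (div_le_one hpos).2
      ((Finset.sum_le_card_nsmul _ _ 1 fun c _ => (hμ.mem_Icc _).2).trans ?_)
    simp
  · simp only [Set.preimage_union]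
    rw [← add_div, ← Finset.sum_add_distrib]
    congr 1
    exact Finset.sum_congr rfl fun c _ => hμ.union_of_disjoint _ _ (hAB.preimage _)
  · simp [hμ.univ, hpos.ne']
  · congr 1
    refine Eq.trans (Finset.sum_congr rfl fun c _ => ?_) (Equiv.sum_comp
      (MulAction.toPerm h : Equiv.Perm (H ⧸ K)) fun c => μ (Prod.mk c ⁻¹' A))
    exact hμ.preimage_smul (inducedCocycle K h c) (Prod.mk (h • c) ⁻¹' A)

theorem infinite_orbit_induced (hX : ∀ x : X, (MulAction.orbit K x).Infinite)
    (z : (H ⧸ K) × X) :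
    letI := inducedMulAction K X
    (MulAction.orbit H z).Infinite := by
  let := inducedMulAction K X
  obtain ⟨c, x⟩ := z
  refine ((hX x).image (Prod.mk_right_injective c).injOn).mono ?_
  rintro _ ⟨_, ⟨k, rfl⟩, rfl⟩
  -- This element fixes `c` and has cocycle `k` there.
  have hc : (c.out * k * c.out⁻¹) • c = c := by
    rw [← MulAction.Quotient.coe_smul_out]
    conv_rhs => rw [← QuotientGroup.out_eq' c]
    exact QuotientGroup.eq.2 (by simp)
  have hk : inducedCocycle K (c.out * k * c.out⁻¹) c = k :=
    Subtype.ext (by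
      change ((c.out * k * c.out⁻¹) • c).out⁻¹ * (c.out * k * c.out⁻¹ * c.out) = k
      rw [hc]
      group)
  refine ⟨c.out * k * c.out⁻¹, ?_⟩
  change ((c.out * k * c.out⁻¹) • c, inducedCocycle K (c.out * k * c.out⁻¹) c • x) = _
  rw [hc, hk]

end Induced

theorem hasLargeOrbitActions_of_infinite_orbits {H X : Type*} [Group H] [MulAction H X]
    [Countable X] (hA : IsAmenableAction H X) (hX : ∀ x : X, (MulAction.orbit H x).Infinite) :
    HasLargeOrbitActions H := fun n =>
  exists_countable_type_le_encard_orbit hA fun x => by simp [(hX x).encard_eq]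

/-- If the indices of the subgroups of finite index are unbounded, the quotients have large orbits.
Otherwise a subgroup `K` of maximal finite index has infinite orbits in every amenable action
without fixed points, and such an action can be induced to `H`. -/
theorem hasLargeOrbitActions_of_not_virtuallyF {H : Type*} [Group H] (hH : ¬ VirtuallyF H) :
    HasLargeOrbitActions H := by
  by_cases hb : BddAbove {n : ℕ | ∃ K : Subgroup H, K.FiniteIndex ∧ K.index = n}
  · obtain ⟨K, hK, hKmax⟩ := Nat.sSup_mem
      (s := {n : ℕ | ∃ K : Subgroup H, K.FiniteIndex ∧ K.index = n})
      ⟨_, (⊤ : Subgroup H), inferInstance, rfl⟩ hb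
    have hKF : ¬ PropertyF K := fun hF => hH ⟨K, hK, hF⟩
    simp only [PropertyF, not_forall] at hKF
    obtain ⟨X, _, _, hA, hfix⟩ := hKF
    have horb : ∀ x : X, (MulAction.orbit K x).Infinite := by
      intro x hfin
      have hS : (MulAction.stabilizer K x).index ≠ 0 := by
        rw [MulAction.index_stabilizer]
        exact (Set.ncard_pos hfin).2 (MulAction.nonempty_orbit x) |>.ne'
      have hL := Subgroup.index_map_subtype (MulAction.stabilizer K x)
      have hle : ((MulAction.stabilizer K x).map K.subtype).index ≤ K.index := by
        rw [hKmax]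
        exact le_csSup hb ⟨_, ⟨by rw [hL]; exact mul_ne_zero hS hK.index_ne_zero⟩, rfl⟩
      have h1 : (MulAction.stabilizer K x).index = 1 := by
        rw [hL] at hle
        have hpos := Nat.pos_of_ne_zero hK.index_ne_zero
        nlinarith [Nat.pos_of_ne_zero hS]
      rw [Subgroup.index_eq_one] at h1
      exact hfix ⟨x, fun k => MulAction.mem_stabilizer_iff.1 (h1 ▸ Subgroup.mem_top k)⟩
    let := inducedMulAction K X
    have : Finite (H ⧸ K) := Subgroup.finite_quotient_of_finiteIndex
    exact hasLargeOrbitActions_of_infinite_orbits (isAmenableAction_induced K hA)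
      (infinite_orbit_induced K horb)
  · intro n
    simp only [bddAbove_def, not_exists, not_forall, not_le] at hb
    obtain ⟨_, ⟨K, hK, rfl⟩, hn⟩ := hb n
    have : Finite (H ⧸ K) := Subgroup.finite_quotient_of_finiteIndex
    refine exists_countable_type_le_encard_orbit (isAmenableAction_of_finite H (H ⧸ K)) fun x => ?_
    rw [MulAction.orbit_eq_univ, Set.encard_univ, ENat.card_eq_coe_natCard]
    exact Nat.cast_le.2 hn.le

theorem PropertyF.of_not_hasLargeOrbitActions {G : Type*} [Group G]
    (hG : ¬ HasLargeOrbitActions G) (hK : ∀ K : Subgroup G, K.FiniteIndex → K = ⊤) :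
    PropertyF G := by
  intro X _ _ hA
  by_contra hfix
  refine hG (hasLargeOrbitActions_of_infinite_orbits hA fun x hfin => hfix ⟨x, fun g => ?_⟩)
  have hS : (MulAction.stabilizer G x).index ≠ 0 := by
    rw [MulAction.index_stabilizer]
    exact (Set.ncard_pos hfin).2 (MulAction.nonempty_orbit x) |>.ne'
  exact MulAction.mem_stabilizer_iff.1 (hK _ ⟨hS⟩ ▸ Subgroup.mem_top g)

/-! ### Two proper subgroups of finite index -/

section Ladder

variable {G H A B : Type*} [Group G] [Group H] [MulAction G A] [MulAction H B]

/-- The action of `G` on `A × B × ℤ` by the first coordinate, conjugated by the shift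
`(a, b, n) ↦ (a, b, n + f a b)`. -/
def shiftedHom (G : Type*) {A B : Type*} [Group G] [MulAction G A] (f : A → B → ℤ) :
    G →* Equiv.Perm (A × B × ℤ) :=
  MonoidHom.toHomPerm
    { toFun := fun g z => (g • z.1, z.2.1, z.2.2 + f (g • z.1) z.2.1 - f z.1 z.2.1)
      map_one' := by
        funext ⟨a, b, n⟩
        change (_, _, _) = (_, _, _)
        simp
      map_mul' := by
        rintro g k
        funext ⟨a, b, n⟩
        change (_, _, _) = (_, _, _)
        simp only [mul_smul, Prod.mk.injEq, true_and]
        ring }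

/-- The action of `G * H` on `A × B × ℤ` in which `H` acts by the second coordinate and `G` by the
first one, conjugated by a shift of the third coordinate. -/
@[reducible] def ladderAction (G H : Type*) {A B : Type*} [Group G] [Group H] [MulAction G A]
    [MulAction H B] (f : A → B → ℤ) : MulAction (Coprod G H) (A × B × ℤ) :=
  MulAction.compHom _ (Coprod.lift (shiftedHom G f) (MonoidHom.toHomPerm
    { toFun := fun h z => (z.1, h • z.2.1, z.2.2)
      map_one' := by
        funext ⟨a, b, n⟩
        change (_, _, _) = (_, _, _)
        simp
      map_mul' := by
        rintro h k
        funext ⟨a, b, n⟩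
        change (_, _, _) = (_, _, _)
        simp only [mul_smul] } : H →* Equiv.Perm (A × B × ℤ)))

theorem ladderAction_inl (f : A → B → ℤ) (g : G) (a : A) (b : B) (n : ℤ) :
    letI := ladderAction G H f
    (Coprod.inl g : Coprod G H) • (a, b, n) = (g • a, b, n + f (g • a) b - f a b) := rfl

/-- If `f` is the indicator function of a point, then along the circuit
`(a₀, b₀), (a₁, b₀), (a₁, b₁), (a₀, b₁), (a₀, b₀)` the third coordinate changes by one. -/
theorem ladderAction_transitive [MulAction.IsPretransitive G A] [MulAction.IsPretransitive H B]
    [DecidableEq A] [DecidableEq B] {a₀ a₁ : A} {b₀ b₁ : B} (ha : a₁ ≠ a₀) (hb : b₁ ≠ b₀)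
    (z : A × B × ℤ) :
    letI := ladderAction G H fun a b => if a = a₀ ∧ b = b₀ then 1 else 0
    z ∈ MulAction.orbit (Coprod G H) (a₀, b₀, (0 : ℤ)) := by
  let := ladderAction G H fun a b => if a = a₀ ∧ b = b₀ then (1 : ℤ) else 0
  have stepB : ∀ (a : A) (b b' : B) (n : ℤ),
      (a, b', n) ∈ MulAction.orbit (Coprod G H) (a, b, n) := by
    intro a b b' n
    obtain ⟨h, rfl⟩ := MulAction.exists_smul_eq H b b'
    exact ⟨Coprod.inr h, rfl⟩
  have stepA : ∀ (a a' : A) (b : B) (n : ℤ), (a', b, n + (if a' = a₀ ∧ b = b₀ then 1 else 0)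
      - if a = a₀ ∧ b = b₀ then 1 else 0) ∈ MulAction.orbit (Coprod G H) (a, b, n) := by
    intro a a' b n
    obtain ⟨g, rfl⟩ := MulAction.exists_smul_eq G a a'
    exact ⟨Coprod.inl g, rfl⟩
  have trans : ∀ {x y z : A × B × ℤ}, y ∈ MulAction.orbit (Coprod G H) x →
      z ∈ MulAction.orbit (Coprod G H) y → z ∈ MulAction.orbit (Coprod G H) x := by
    intro x y z hy hz
    rwa [MulAction.orbit_eq_iff.2 hy] at hz
  have symm : ∀ {x y : A × B × ℤ}, y ∈ MulAction.orbit (Coprod G H) x →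
      x ∈ MulAction.orbit (Coprod G H) y := fun h => MulAction.mem_orbit_symm.1 h
  have level : ∀ (a a' : A) (b b' : B) (n : ℤ),
      (a', b', n) ∈ MulAction.orbit (Coprod G H) (a, b, n) := by
    intro a a' b b' n
    have h := stepA a a' b₁ n
    simp only [hb, and_false, if_false, add_zero, sub_zero] at h
    exact trans (trans (stepB a b b₁ n) h) (stepB a' b₁ b' n)
  have up : ∀ n : ℤ, (a₀, b₀, n + 1) ∈ MulAction.orbit (Coprod G H) (a₀, b₀, n) := by
    intro n
    have h := stepA a₁ a₀ b₀ n
    simp only [ha, false_and, and_self, if_true, if_false, sub_zero] at h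
    exact trans (level a₀ a₁ b₀ b₀ n) h
  have base : ∀ n : ℤ, (a₀, b₀, n) ∈ MulAction.orbit (Coprod G H) (a₀, b₀, (0 : ℤ)) := by
    intro n
    induction n using Int.induction_on with
    | zero => exact MulAction.mem_orbit_self _
    | succ n ih => exact trans ih (up _)
    | pred n ih =>
      refine trans ih (symm ?_)
      simpa using up (-(n : ℤ) - 1)
  obtain ⟨a, b, n⟩ := z
  exact trans (base n) (level a₀ a b₀ b n)

theorem exists_abs_sub_le_ladderAction (f : A → B → ℤ) (hf : ∀ a b, f a b ∈ Set.Icc 0 1)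
    (w : Coprod G H) :
    letI := ladderAction G H f
    ∃ C : ℕ, ∀ z : A × B × ℤ, |(w • z).2.2 - z.2.2| ≤ C := by
  let := ladderAction G H f
  induction w using Coprod.induction_on' with
  | one => exact ⟨0, fun z => by simp⟩
  | inl_mul g w ih =>
    obtain ⟨C, hC⟩ := ih
    refine ⟨C + 1, fun z => ?_⟩
    have h1 := hC z
    rw [mul_smul]
    generalize w • z = y at *
    obtain ⟨a, b, n⟩ := y
    rw [ladderAction_inl]
    have h2 := hf (g • a) b
    have h3 := hf a b
    simp only [Set.mem_Icc, abs_le, Nat.cast_add, Nat.cast_one] at *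
    constructor <;> linarith
  | inr_mul h w ih =>
    obtain ⟨C, hC⟩ := ih
    exact ⟨C, fun z => by rw [mul_smul]; exact hC z⟩

end Ladder

section BoxDensity

variable {A B : Type*} [Fintype A] [Fintype B]

/-- The box `A × B × [0, n]`. -/
noncomputable def box (A B : Type*) [Fintype A] [Fintype B] (n : ℕ) : Finset (A × B × ℤ) :=
  Finset.univ ×ˢ Finset.univ ×ˢ Finset.Ico 0 ((n : ℤ) + 1)

theorem card_box (n : ℕ) :
    (box A B n).card = Fintype.card A * (Fintype.card B * (n + 1)) := by
  simp [box]

open Classical in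
/-- The proportion of the points of the box `A × B × [0, n]` that lie in `S`. -/
noncomputable def boxDensity (n : ℕ) (S : Set (A × B × ℤ)) : ℝ :=
  ((box A B n).filter (· ∈ S)).card / (box A B n).card

open Classical in
theorem card_filter_box_preimage_le (e : Equiv.Perm (A × B × ℤ)) (C : ℕ)
    (hC : ∀ z, |(e z).2.2 - z.2.2| ≤ C) (S : Set (A × B × ℤ)) (n : ℕ) :
    ((box A B n).filter (· ∈ e ⁻¹' S)).card ≤
      ((box A B n).filter (· ∈ S)).card + Fintype.card A * (Fintype.card B * (C + C)) := by
  let E : Finset (A × B × ℤ) := Finset.univ ×ˢ Finset.univ ×ˢ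
    (Finset.Ico (-(C : ℤ)) 0 ∪ Finset.Ico ((n : ℤ) + 1) (n + 1 + C))
  have hE : E.card ≤ Fintype.card A * (Fintype.card B * (C + C)) := by
    simp only [E, Finset.card_product, Finset.card_univ]
    gcongr
    refine (Finset.card_union_le _ _).trans ?_
    simp
  refine le_trans ?_ ((Finset.card_union_le ((box A B n).filter (· ∈ S)) E).trans (by gcongr))
  refine Finset.card_le_card_of_injOn e (fun z hz => ?_) e.injective.injOn
  have h := abs_le.1 (hC z)
  simp only [box, E, Finset.coe_filter, Finset.mem_product, Finset.mem_univ, true_and,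
    Finset.mem_Ico, Set.mem_ofPred_eq, Set.mem_preimage, Finset.coe_union, Set.mem_union,
    Finset.mem_coe, Finset.mem_union] at hz ⊢
  by_cases hz' : 0 ≤ (e z).2.2 ∧ (e z).2.2 < n + 1
  · exact Or.inl ⟨hz', hz.2⟩
  · right; omega

theorem abs_boxDensity_preimage_sub_le [Nonempty A] [Nonempty B] (e : Equiv.Perm (A × B × ℤ))
    (C : ℕ) (hC : ∀ z, |(e z).2.2 - z.2.2| ≤ C) (S : Set (A × B × ℤ)) (n : ℕ) :
    |boxDensity n (e ⁻¹' S) - boxDensity n S| ≤ (C + C) * (1 / ((n : ℝ) + 1)) := by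
  classical
  have hA : (0 : ℝ) < Fintype.card A := Nat.cast_pos.2 Fintype.card_pos
  have hB : (0 : ℝ) < Fintype.card B := Nat.cast_pos.2 Fintype.card_pos
  have h1 := card_filter_box_preimage_le e C hC S n
  have h2 := card_filter_box_preimage_le e.symm C (fun z => by
    have := hC (e.symm z)
    rwa [e.apply_symm_apply, abs_sub_comm] at this) (e ⁻¹' S) n
  rw [← Set.preimage_comp, e.self_comp_symm, Set.preimage_id] at h2
  have h1' := (Nat.cast_le (α := ℝ)).2 h1
  have h2' := (Nat.cast_le (α := ℝ)).2 h2
  push_cast at h1' h2'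
  rw [boxDensity, boxDensity, card_box, ← sub_div, abs_div, mul_one_div]
  push_cast
  rw [abs_of_pos (by positivity : (0 : ℝ) < Fintype.card A * (Fintype.card B * (n + 1))),
    div_le_div_iff₀ (by positivity) (by positivity)]
  refine (mul_le_mul_of_nonneg_right (abs_le.2 ⟨by linarith, by linarith⟩ :
    _ ≤ (Fintype.card A : ℝ) * (Fintype.card B * (C + C))) (by positivity)).trans (le_of_eq ?_)
  ring

theorem boxDensity_le_of_finite {S : Set (A × B × ℤ)} (hS : S.Finite) [Nonempty A] [Nonempty B]
    (n : ℕ) : boxDensity n S ≤ S.ncard * (1 / ((n : ℝ) + 1)) := by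
  classical
  rw [boxDensity, card_box, mul_one_div]
  have h1 : ((box A B n).filter (· ∈ S)).card ≤ S.ncard := by
    rw [Set.ncard_eq_toFinset_card S hS]
    exact Finset.card_le_card fun z hz => by simpa using (Finset.mem_filter.1 hz).2
  have h2 : n + 1 ≤ Fintype.card A * (Fintype.card B * (n + 1)) := by
    rw [← mul_assoc]
    exact Nat.le_mul_of_pos_left _ (Nat.mul_pos Fintype.card_pos Fintype.card_pos)
  have h2' := (Nat.cast_le (α := ℝ)).2 h2
  push_cast at h2' ⊢
  gcongr

end BoxDensity

/-- The limit of the uniform distributions on the boxes `A × B × [0, n]` is invariant, since every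
element of `G * H` moves the third coordinate by a bounded amount; the orbit of a point under the
left factor is finite, hence null. -/
theorem inClassA_of_finite_actions {G H A B : Type*} [Group G] [Group H] [Countable G] [Infinite G]
    [Countable H] [Infinite H] [Finite A] [Finite B] [Nontrivial A] [Nontrivial B] [MulAction G A]
    [MulAction H B] [MulAction.IsPretransitive G A] [MulAction.IsPretransitive H B] :
    InClassA (Coprod G H) := by
  classical
  have := Fintype.ofFinite A
  have := Fintype.ofFinite B
  obtain ⟨a₁, a₀, ha⟩ := exists_pair_ne A
  obtain ⟨b₁, b₀, hb⟩ := exists_pair_ne B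
  let f : A → B → ℤ := fun a b => if a = a₀ ∧ b = b₀ then 1 else 0
  let := ladderAction G H f
  have htrans : ∀ z : A × B × ℤ, z ∈ MulAction.orbit (Coprod G H) (a₀, b₀, (0 : ℤ)) :=
    ladderAction_transitive ha hb
  have hf : ∀ a b, f a b ∈ Set.Icc (0 : ℤ) 1 := fun a b => by
    by_cases h : a = a₀ ∧ b = b₀ <;> simp [f, h]
  have hpos : ∀ n, (0 : ℝ) < (box A B n).card := fun n => by
    rw [card_box]
    exact_mod_cast Nat.mul_pos Fintype.card_pos (Nat.mul_pos Fintype.card_pos n.succ_pos)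
  have hlim : ∀ c : ℝ, Tendsto (fun n : ℕ => c * (1 / ((n : ℝ) + 1))) atTop (𝓝 0) := fun c => by
    simpa using tendsto_one_div_add_atTop_nhds_zero_nat.const_mul c
  obtain ⟨μ, hμ, hμ0⟩ := exists_isInvariantMean_of_tendsto (G := Coprod G H)
    (boxDensity (A := A) (B := B))
    (fun n S => ⟨by unfold boxDensity; positivity, (div_le_one (hpos n)).2
      (Nat.cast_le.2 (Finset.card_filter_le _ _))⟩)
    (fun n S T hST => by
      rw [boxDensity, boxDensity, boxDensity, ← add_div, ← Nat.cast_add,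
        ← Finset.card_union_of_disjoint (Finset.disjoint_filter.2 fun z _ hS hT =>
          Set.disjoint_left.1 hST hS hT)]
      congr 3
      ext z
      simp [and_or_left])
    (fun n => by
      unfold boxDensity
      simp only [Set.mem_univ, Finset.filter_true]
      exact div_self (hpos n).ne')
    (fun w S => by
      obtain ⟨C, hC⟩ := exists_abs_sub_le_ladderAction f hf w
      exact squeeze_zero_norm (abs_boxDensity_preimage_sub_le (MulAction.toPerm w) C hC S)
        (hlim (C + C)))
  have hfin : (Set.range fun g : G =>
      (Coprod.inl g : Coprod G H) • (a₀, b₀, (0 : ℤ))).Finite := by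
    refine (Set.finite_range fun a => (a, b₀, (0 : ℤ) + f a b₀ - f a₀ b₀)).subset ?_
    rintro _ ⟨g, rfl⟩
    exact ⟨g • a₀, rfl⟩
  refine inClassA_of_null_set hμ _ ?_ (fun z => ?_) (hμ0 _ (squeeze_zero
    (fun n => by unfold boxDensity; positivity) (boxDensity_le_of_finite hfin) (hlim _)))
  · rintro g _ ⟨k, rfl⟩
    exact ⟨g * k, by simp only [map_mul, mul_smul]⟩
  · obtain ⟨w, hw⟩ := htrans z
    refine ⟨w⁻¹, 1, ?_⟩
    rw [← hw]
    change (Coprod.inl 1 : Coprod G H) • _ = w⁻¹ • w • _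
    rw [map_one, one_smul, inv_smul_smul]

/-! ### The characterization -/

theorem theorem1 {G H : Type*} [Group G] [Group H]
    [Countable G] [Infinite G] [Countable H] [Infinite H] :
    InClassA (Monoid.Coprod G H) ↔
      ¬ ((PropertyF G ∧ VirtuallyF H) ∨ (PropertyF H ∧ VirtuallyF G)) := by
  constructor
  · rintro h (⟨hG, hH⟩ | ⟨hH, hG⟩)
    · exact not_inClassA_of_propertyF hG hH h
    · exact not_inClassA_of_propertyF hH hG (h.of_mulEquiv (MulEquiv.coprodComm G H))
  · intro hF
    by_cases hlH : HasLargeOrbitActions H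
    · exact hlH.inClassA
    by_cases hlG : HasLargeOrbitActions G
    · exact hlG.inClassA.of_mulEquiv (MulEquiv.coprodComm H G)
    have hvG : VirtuallyF G := not_not.1 fun h => hlG (hasLargeOrbitActions_of_not_virtuallyF h)
    have hvH : VirtuallyF H := not_not.1 fun h => hlH (hasLargeOrbitActions_of_not_virtuallyF h)
    obtain ⟨K, hK, hKtop⟩ : ∃ K : Subgroup G, K.FiniteIndex ∧ K ≠ ⊤ := by
      by_contra! hall
      exact hF (Or.inl ⟨.of_not_hasLargeOrbitActions hlG hall, hvH⟩)
    obtain ⟨L, hL, hLtop⟩ : ∃ L : Subgroup H, L.FiniteIndex ∧ L ≠ ⊤ := by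
      by_contra! hall
      exact hF (Or.inr ⟨.of_not_hasLargeOrbitActions hlH hall, hvG⟩)
    have : Nontrivial (G ⧸ K) := QuotientGroup.nontrivial_iff.2 hKtop
    have : Nontrivial (H ⧸ L) := QuotientGroup.nontrivial_iff.2 hLtop
    have : Finite (G ⧸ K) := Subgroup.finite_quotient_of_finiteIndex
    have : Finite (H ⧸ L) := Subgroup.finite_quotient_of_finiteIndex
    exact inClassA_of_finite_actions (A := G ⧸ K) (B := H ⧸ L)
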